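/- All graphs are finite, simple and undirected. Let $N_G(v)$ denote the neighborhood of a vertex $v$ in a graph $G$, and $G+H$ the disjoint union of $G$ and $H$. A set $S$ of vertices of a graph $G=(V,E)$ is *total dominating* if every vertex of $G$ has a neighbor in $S$. The graph $G$ is *total domishold* if there are weights $w:V\to\mathbb{R}_{\ge 0}$ and a threshold $t\in\mathbb{R}_{\ge 0}$ such that for every $S\subseteq V$, $\sum_{x\in S}w(x)\ge t$ if and only if $S$ is a total dominating set of $G$; it is *hereditary total domishold* if every induced subgraph of $G$ is total domishold. The *neighborhood function* of $G$ is $f_G:\{0,1\}^V\to\{0,1\}$, $f_G(x)=\bigvee_{v\in V}\bigwedge_{u\in N_G(v)}x_u$ (an empty conjunction equals $1$, an empty disjunction $0$). A Boolean function $f:\{0,1\}^V\to\{0,1\}$ is *$2$-asummable* if there are no (not necessarily distinct) $x^1,x^2$ with $f(x^1)=f(x^2)=0$ and $y^1,y^2$ with $f(y^1)=f(y^2)=1$ such that $x^1+x^2=y^1+y^2$ in $\mathbb{Z}^V$. The graph $G$ is *hereditary $2$-asummable* if the neighborhood function of every induced subgraph of $G$ is $2$-asummable. Let $F_1=C_4$,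 $F_2=C_5$, $F_3=C_6$, $F_4=P_6$, $F_5=2P_3$, $F_6=P_3+K_3$, $F_7=2K_3$ (where $C_n,P_n,K_n$ are the cycle, path and complete graph on $n$ vertices), and let $F_8,\dots,F_{13}$ be the graphs with vertex set $\{u,v,a,b,c,d\}$ whose edges are $ua,ub,vc,vd$ together with - $F_8$: $ac,\ ab$; - $F_9$: $ac,\ bc,\ ab$; - $F_{10}$: $ac,\ ab,\ cd$; - $F_{11}$: $ac,\ bc,\ ab,\ cd$; - $F_{12}$: $ac,\ bc,\ bd,\ ab,\ cd$; - $F_{13}$: $ac,\ ad,\ bc,\ bd,\ ab,\ cd$. **Theorem.** For every graph $G$, the following are equivalent: 1. $G$ is hereditary total domishold. 2. $G$ is hereditary $2$-asummable. 3. $G$ is $\{F_1,\dots,F_{13}\}$-free, that is, no induced subgraph of $G$ is isomorphic to one of $F_1,\dots,F_{13}$. -/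

import Mathlib

namespace TotalDomishold

open SimpleGraph

/-- `S` is a total dominating set of `G`: every vertex of `G` has a neighbor in `S`. -/
def IsTotalDominating {V : Type*} (G : SimpleGraph V) (S : Finset V) : Prop :=
  ∀ v, ∃ u ∈ S, G.Adj v u

/-- A finite graph is total domishold if there are non-negative real vertex weights `w` and a
non-negative real threshold `t` such that the vertex sets of weight at least `t` are exactly
the total dominating sets. -/
def IsTotalDomishold {V : Type*} [Finite V] (G : SimpleGraph V) : Prop :=
  ∃ (w : V → ℝ) (t : ℝ), (∀ v, 0 ≤ w v) ∧ 0 ≤ t ∧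
    ∀ S : Finset V, t ≤ ∑ v ∈ S, w v ↔ IsTotalDominating G S

/-- Every induced subgraph is total domishold. -/
def IsHereditaryTotalDomishold {V : Type*} [Finite V] (G : SimpleGraph V) : Prop :=
  ∀ s : Set V, IsTotalDomishold (G.induce s)

open Classical in
/-- The neighborhood function `f_G(x) = ⋁_v ⋀_{u ∈ N(v)} x_u`. -/
noncomputable def neighborhoodFunction {V : Type*} (G : SimpleGraph V) : (V → Bool) → Bool :=
  fun x => decide (∃ v, ∀ u ∈ G.neighborSet v, x u = true)

/-- A Boolean function is `k`-summable if, for some `2 ≤ r ≤ k`, there are `r` false points and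
`r` true points (repetitions allowed) with the same sum, taken coordinatewise in the integers. -/
def IsSummable {V : Type*} (k : ℕ) (f : (V → Bool) → Bool) : Prop :=
  ∃ r : ℕ, 2 ≤ r ∧ r ≤ k ∧ ∃ x y : Fin r → V → Bool,
    (∀ i, f (x i) = false) ∧ (∀ i, f (y i) = true) ∧
      ∀ v, ∑ i, (x i v).toNat = ∑ i, (y i v).toNat

/-- A Boolean function is `k`-asummable if it is not `k`-summable. -/
def IsAsummable {V : Type*} (k : ℕ) (f : (V → Bool) → Bool) : Prop :=
  ¬ IsSummable k f

/-- Every induced subgraph has a 2-asummable neighborhood function. -/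
def IsHereditaryTwoAsummable {V : Type*} (G : SimpleGraph V) : Prop :=
  ∀ s : Set V, IsAsummable 2 (neighborhoodFunction (G.induce s))

/-- `P_6` (path `0 1 2 3 4 5`) with the chord `02`: a triangle with a path attached. -/
def F8 : SimpleGraph (Fin 6) :=
  fromEdgeSet {s(0, 1), s(1, 2), s(2, 3), s(3, 4), s(4, 5), s(0, 2)}

/-- The diamond on `0, 1, 2, 3` (with `0` and `3` non-adjacent) and the path `3 4 5` attached
at the degree-two vertex `3`. -/
def F9 : SimpleGraph (Fin 6) :=
  fromEdgeSet {s(0, 1), s(0, 2), s(1, 2), s(1, 3), s(2, 3), s(3, 4), s(4, 5)}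

/-- `P_6` with the chords `02` and `35`: two disjoint triangles joined by one edge. -/
def F10 : SimpleGraph (Fin 6) :=
  fromEdgeSet {s(0, 1), s(1, 2), s(2, 3), s(3, 4), s(4, 5), s(0, 2), s(3, 5)}

/-- The diamond on `0, 1, 2, 3` (with `0` and `3` non-adjacent) and the triangle `3 4 5`, sharing
the vertex `3`. -/
def F11 : SimpleGraph (Fin 6) :=
  fromEdgeSet {s(0, 1), s(0, 2), s(1, 2), s(1, 3), s(2, 3), s(3, 4), s(4, 5), s(3, 5)}

/-- Two disjoint triangles `0 1 2` and `3 4 5` joined by the three edges `13`, `23`, `24`: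
the square of the path `0 1 2 3 4 5`. -/
def F12 : SimpleGraph (Fin 6) :=
  fromEdgeSet {s(0, 1), s(0, 2), s(1, 2), s(1, 3), s(2, 3), s(2, 4), s(3, 4), s(3, 5), s(4, 5)}

/-- The complete graph on `1, 2, 3, 4`, a vertex `0` adjacent to exactly `1, 2`, and a vertex `5`
adjacent to exactly `3, 4`. -/
def F13 : SimpleGraph (Fin 6) :=
  fromEdgeSet {s(1, 2), s(1, 3), s(1, 4), s(2, 3), s(2, 4), s(3, 4),
    s(0, 1), s(0, 2), s(3, 5), s(4, 5)}

/-- The forbidden graphs `F_1, …, F_13`: `C_4`, `C_5`, `C_6`, `P_6`, `2P_3`, `P_3 + K_3`, `2K_3`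
and the six graphs above. -/
def forbidden : Fin 13 → Σ W : Type, SimpleGraph W :=
  ![⟨Fin 4, cycleGraph 4⟩, ⟨Fin 5, cycleGraph 5⟩, ⟨Fin 6, cycleGraph 6⟩, ⟨Fin 6, pathGraph 6⟩,
    ⟨Fin 3 ⊕ Fin 3, pathGraph 3 ⊕g pathGraph 3⟩,
    ⟨Fin 3 ⊕ Fin 3, pathGraph 3 ⊕g completeGraph (Fin 3)⟩,
    ⟨Fin 3 ⊕ Fin 3, completeGraph (Fin 3) ⊕g completeGraph (Fin 3)⟩,
    ⟨Fin 6, F8⟩, ⟨Fin 6, F9⟩, ⟨Fin 6, F10⟩, ⟨Fin 6, F11⟩, ⟨Fin 6, F12⟩, ⟨Fin 6, F13⟩]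

/-- `G` has no induced subgraph isomorphic to a member of the family `F`. -/
def IsFree {V : Type*} {ι : Type*} (F : ι → Σ W : Type, SimpleGraph W) (G : SimpleGraph V) : Prop :=
  ∀ i, ¬ (F i).2.IsIndContained G

end TotalDomishold

/-!
A neighborhood function is monotone, and a total domishold graph is one whose neighborhood function
is a threshold function up to complementing the argument. Weighing the two sides of an equality
`x¹ + x² = y¹ + y²` shows that threshold functions are `2`-asummable. No forbidden graph is
`2`-asummable: it has vertices `u`, `v` with neighborhoods inside two pairs `{a, b}`, `{c, d}`,
whereas neither `{a, c}` nor `{b, d}` contains a neighborhood.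

Conversely, if no forbidden graph is induced, then of any two inclusion-minimal neighborhoods one
has exactly one vertex outside the other: they form a `1`-Sperner family. Comparing a smallest and
a largest member of such a family yields a vertex `z` such that every member through `z`, with
`z` removed, lies inside every member avoiding `z`. Both parts are again `1`-Sperner, so they have
separating weights by induction, and the inclusion allows these to be combined into weights for the
whole family.
-/

namespace TotalDomishold

open SimpleGraph Function
open scoped Finset

section Asummability

variable {V W : Type*} {G : SimpleGraph V} {H : SimpleGraph W}

theorem neighborhoodFunction_eq_false_iff (x : V → Bool) :
    neighborhoodFunction G x = false ↔ ∀ v, ∃ u, G.Adj v u ∧ x u = false := by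
  simp [neighborhoodFunction]

theorem neighborhoodFunction_eq_true_iff (x : V → Bool) :
    neighborhoodFunction G x = true ↔ ∃ v, ∀ u, G.Adj v u → x u = true := by
  simp [neighborhoodFunction]

theorem neighborhoodFunction_comp_iso (e : G ≃g H) (x : W → Bool) :
    neighborhoodFunction G (x ∘ e) = neighborhoodFunction H x := by
  rw [Bool.eq_iff_iff]
  simp [neighborhoodFunction, e.surjective.exists, e.surjective.forall, e.map_adj_iff]

theorem isTotalDominating_filter_iff [Fintype V] (x : V → Bool) :
    IsTotalDominating G {v | x v = false} ↔ neighborhoodFunction G x = false := by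
  simp [neighborhoodFunction_eq_false_iff, IsTotalDominating, and_comm]

theorem sum_sum_filter_eq_false {ι R : Type*} [Fintype ι] [Fintype V] [Ring R] (w : V → R)
    (x : ι → V → Bool) : ∑ i, ∑ v with x i v = false, w v =
      ∑ v, (Fintype.card ι - ∑ i, ((x i v).toNat : R)) * w v := by
  have hterm (i : ι) (v : V) :
      (if x i v = false then w v else 0) = (1 - ((x i v).toNat : R)) * w v := by
    cases x i v <;> simp
  simp only [Finset.sum_filter, hterm]
  rw [Finset.sum_comm]
  simp [← Finset.sum_mul]

theorem IsTotalDomishold.isAsummable [Finite V] (h : IsTotalDomishold G) (k : ℕ) :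
    IsAsummable k (neighborhoodFunction G) := by
  have := Fintype.ofFinite V
  obtain ⟨w, t, -, -, hw⟩ := h
  rintro ⟨r, hr, -, x, y, hx, hy, hxy⟩
  have heavy (i : Fin r) : t ≤ ∑ v with x i v = false, w v :=
    (hw _).2 ((isTotalDominating_filter_iff _).2 (hx i))
  have light (i : Fin r) : ∑ v with y i v = false, w v < t := by
    rw [← not_le, hw, isTotalDominating_filter_iff, hy i]
    simp
  have : NeZero r := ⟨by lia⟩
  have hlt : ∑ i, ∑ v with y i v = false, w v < ∑ i, ∑ v with x i v = false, w v :=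
    Finset.sum_lt_sum_of_nonempty Finset.univ_nonempty fun i _ => (light i).trans_le (heavy i)
  simp only [sum_sum_filter_eq_false, ← Nat.cast_sum, hxy, lt_irrefl] at hlt

theorem IsSummable.neighborhoodFunction_of_iso {k : ℕ}
    (h : IsSummable k (neighborhoodFunction H)) (e : G ≃g H) :
    IsSummable k (neighborhoodFunction G) := by
  obtain ⟨r, hr, hrk, x, y, hx, hy, hxy⟩ := h
  exact ⟨r, hr, hrk, fun i => x i ∘ e, fun i => y i ∘ e,
    fun i => (neighborhoodFunction_comp_iso e _).trans (hx i),
    fun i => (neighborhoodFunction_comp_iso e _).trans (hy i), fun v => hxy (e v)⟩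

/- The neighborhoods of `u` and `v` make `{a, b}` and `{c, d}` true points of `f_H`, whereas
`{a, c}` and `{b, d}` are false points with the same sum. -/
theorem isSummable_two_of_neighbors_pair (u v a b c d : W)
    (hab : a ≠ b := by decide) (hcd : c ≠ d := by decide)
    (hac : a ≠ c := by decide) (hbd : b ≠ d := by decide)
    (hu : ∀ x, H.Adj u x → x = a ∨ x = b := by decide)
    (hv : ∀ x, H.Adj v x → x = c ∨ x = d := by decide)
    (not_subset_ac : ∀ w, ∃ x, H.Adj w x ∧ ¬ (x = a ∨ x = c) := by decide)
    (not_subset_bd : ∀ w, ∃ x, H.Adj w x ∧ ¬ (x = b ∨ x = d) := by decide) :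
    IsSummable 2 (neighborhoodFunction H) := by
  classical
  let ind (p q : W) : W → Bool := fun w => decide (w = p ∨ w = q)
  refine ⟨2, le_rfl, le_rfl, ![ind a c, ind b d], ![ind a b, ind c d], ?_, ?_, fun w => ?_⟩
  · simp only [Fin.forall_fin_two, neighborhoodFunction_eq_false_iff]
    exact ⟨by simpa [ind] using not_subset_ac, by simpa [ind] using not_subset_bd⟩
  · simp only [Fin.forall_fin_two, neighborhoodFunction_eq_true_iff]
    exact ⟨⟨u, by simpa [ind] using hu⟩, ⟨v, by simpa [ind] using hv⟩⟩
  · by_cases w = a <;> by_cases w = b <;> by_cases w = c <;> by_cases w = d <;> simp_all [ind]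

end Asummability

section ForbiddenGraphs

instance decidableRelPathGraphAdj (n : ℕ) : DecidableRel (pathGraph n).Adj :=
  fun _ _ => decidable_of_iff' _ pathGraph_adj

instance decidableRelSumAdj {V W : Type*} (G : SimpleGraph V) (H : SimpleGraph W)
    [DecidableRel G.Adj] [DecidableRel H.Adj] : DecidableRel (G ⊕g H).Adj
  | .inl a, .inl b => inferInstanceAs (Decidable (G.Adj a b))
  | .inr a, .inr b => inferInstanceAs (Decidable (H.Adj a b))
  | .inl _, .inr _ => isFalse (by simp)
  | .inr _, .inl _ => isFalse (by simp)

instance : DecidableRel F8.Adj := inferInstanceAs (DecidableRel (fromEdgeSet _).Adj)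
instance : DecidableRel F9.Adj := inferInstanceAs (DecidableRel (fromEdgeSet _).Adj)
instance : DecidableRel F10.Adj := inferInstanceAs (DecidableRel (fromEdgeSet _).Adj)
instance : DecidableRel F11.Adj := inferInstanceAs (DecidableRel (fromEdgeSet _).Adj)
instance : DecidableRel F12.Adj := inferInstanceAs (DecidableRel (fromEdgeSet _).Adj)
instance : DecidableRel F13.Adj := inferInstanceAs (DecidableRel (fromEdgeSet _).Adj)

theorem isSummable_two_forbidden :
    ∀ i, IsSummable 2 (neighborhoodFunction (forbidden i).2)
  | 0 => isSummable_two_of_neighbors_pair (H := cycleGraph 4) 0 1 1 3 0 2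
  | 1 => isSummable_two_of_neighbors_pair (H := cycleGraph 5) 0 1 1 4 2 0
  | 2 => isSummable_two_of_neighbors_pair (H := cycleGraph 6) 0 1 1 5 0 2
  | 3 => isSummable_two_of_neighbors_pair (H := pathGraph 6) 1 4 0 2 3 5
  | 4 => isSummable_two_of_neighbors_pair (H := pathGraph 3 ⊕g pathGraph 3)
      (.inl 1) (.inr 1) (.inl 0) (.inl 2) (.inr 0) (.inr 2)
  | 5 => isSummable_two_of_neighbors_pair (H := pathGraph 3 ⊕g completeGraph (Fin 3))
      (.inl 1) (.inr 1) (.inl 0) (.inl 2) (.inr 0) (.inr 2)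
  | 6 => isSummable_two_of_neighbors_pair
      (H := completeGraph (Fin 3) ⊕g completeGraph (Fin 3))
      (.inl 1) (.inr 1) (.inl 0) (.inl 2) (.inr 0) (.inr 2)
  | 7 => isSummable_two_of_neighbors_pair (H := F8) 0 4 1 2 3 5
  | 8 => isSummable_two_of_neighbors_pair (H := F9) 0 4 1 2 3 5
  | 9 => isSummable_two_of_neighbors_pair (H := F10) 0 4 1 2 3 5
  | 10 => isSummable_two_of_neighbors_pair (H := F11) 0 4 1 2 3 5
  | 11 => isSummable_two_of_neighbors_pair (H := F12) 0 5 1 2 3 4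
  | 12 => isSummable_two_of_neighbors_pair (H := F13) 0 5 1 2 3 4

theorem IsHereditaryTwoAsummable.isFree {V : Type*} {G : SimpleGraph V}
    (h : IsHereditaryTwoAsummable G) : IsFree forbidden G := by
  intro i hi
  obtain ⟨s, ⟨e⟩⟩ := isIndContained_iff_exists_iso_induce.1 hi
  exact h s ((isSummable_two_forbidden i).neighborhoodFunction_of_iso e.symm)

end ForbiddenGraphs

section OneSperner

variable {V : Type*} [DecidableEq V] {A B : Finset (Finset V)} {e f g h S : Finset V} {z y : V}
  {w w₁ w₂ : V → ℕ} {t t₁ t₂ : ℕ}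

/-- A family of sets is `1`-Sperner if of any two distinct members `e`, `f` the smaller of the
two differences `e \ f` and `f \ e` is a singleton. -/
def IsOneSperner (A : Finset (Finset V)) : Prop :=
  (A : Set (Finset V)).Pairwise fun e f => min #(e \ f) #(f \ e) = 1

theorem erase_subset_of_card_sdiff_le_one (hef : #(e \ f) ≤ 1) (hz : z ∈ e \ f) :
    e.erase z ⊆ f := by
  intro x hx
  by_contra hxf
  have hxz := Finset.card_le_one.1 hef x (by simp_all) z hz
  simp_all

theorem IsOneSperner.mono (hA : IsOneSperner A) (hBA : B ⊆ A) : IsOneSperner B :=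
  Set.Pairwise.mono (Finset.coe_subset.2 hBA) hA

theorem IsOneSperner.eq_of_subset (hA : IsOneSperner A) (he : e ∈ A) (hf : f ∈ A)
    (hef : e ⊆ f) : e = f := by
  by_contra hne
  have := hA he hf hne
  simp [Finset.sdiff_eq_empty_iff_subset.2 hef] at this

theorem IsOneSperner.erase_subset (hA : IsOneSperner A) (he : e ∈ A) (hf : f ∈ A)
    (hcard : #e ≤ #f) (hz : z ∈ e \ f) : e.erase z ⊆ f := by
  have hne : e ≠ f := by rintro rfl; simp at hz
  have hmin : min #(e \ f) #(f \ e) = 1 := hA he hf hne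
  rw [min_eq_left (Finset.card_sdiff_le_card_sdiff_iff.2 hcard)] at hmin
  exact erase_subset_of_card_sdiff_le_one hmin.le hz

theorem IsOneSperner.erase_subset_or (hA : IsOneSperner A) (he : e ∈ A) (hf : f ∈ A)
    (hz : z ∈ e \ f) (hy : y ∈ f \ e) : e.erase z ⊆ f ∨ f.erase y ⊆ e :=
  (le_total #e #f).imp (hA.erase_subset he hf · hz) (hA.erase_subset hf he · hy)

theorem IsOneSperner.erase_subset_of_extremal (hA : IsOneSperner A) (he : e ∈ A) (hf : f ∈ A)
    (hmin : ∀ g ∈ A, #e ≤ #g) (hmax : ∀ g ∈ A, #g ≤ #f) (hz : z ∈ e \ f)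
    (hg : g ∈ A) (hzg : z ∈ g) (hh : h ∈ A) (hzh : z ∉ h) : g.erase z ⊆ h := by
  obtain ⟨hze, hzf⟩ := Finset.mem_sdiff.1 hz
  have e_sub_h : e.erase z ⊆ h := hA.erase_subset he hh (hmin h hh) (by simp [hze, hzh])
  have e_sub_f : e.erase z ⊆ f := hA.erase_subset he hf (hmax e he) hz
  have g_sub_f : g.erase z ⊆ f := hA.erase_subset hg hf (hmax g hg) (by simp [hzg, hzf])
  intro x hx
  by_contra hxh
  have hxf := g_sub_f hx
  have hge : g ≠ e := by rintro rfl; exact hxh (e_sub_h hx)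
  obtain ⟨y, hye, hyg⟩ := Finset.not_subset.1 fun hsub => hge (hA.eq_of_subset he hg hsub).symm
  have hy : y ∈ e.erase z := Finset.mem_erase.2 ⟨by rintro rfl; exact hyg hzg, hye⟩
  have h_sub_g : h.erase y ⊆ g :=
    (hA.erase_subset_or hg hh (by simp [hzg, hzh]) (by simp [e_sub_h hy, hyg])).resolve_left
      fun hsub => hxh (hsub hx)
  have h_sub_f : h ⊆ f := by
    intro s hs
    by_cases hsy : s = y
    · exact hsy ▸ e_sub_f hy
    · exact g_sub_f (by grind)
  exact hxh (hA.eq_of_subset hh hf h_sub_f ▸ hxf)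

/-- A vertex `z` splits the family `A` if the members containing `z`, with `z` removed, are all
contained in all members avoiding `z`. -/
def IsSplittingVertex (A : Finset (Finset V)) (z : V) : Prop :=
  ∀ e ∈ A.memberSubfamily z, ∀ f ∈ A.nonMemberSubfamily z, e ⊆ f

theorem IsOneSperner.exists_isSplittingVertex (hA : IsOneSperner A) (hcard : 1 < #A) :
    ∃ z, IsSplittingVertex A z ∧ (A.memberSubfamily z).Nonempty ∧
      (A.nonMemberSubfamily z).Nonempty := by
  obtain ⟨e, he, hmin⟩ := A.exists_min_image Finset.card (Finset.card_pos.1 (by lia))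
  obtain ⟨f, hf, hmax⟩ := (A.erase e).exists_max_image Finset.card
    ((Finset.erase_nonempty he).2 (Finset.one_lt_card_iff_nontrivial.1 hcard))
  obtain ⟨hfe, hfA⟩ := Finset.mem_erase.1 hf
  have hmax' (g : Finset V) (hg : g ∈ A) : #g ≤ #f := by
    by_cases hge : g = e
    · exact hge ▸ hmin f hfA
    · exact hmax g (Finset.mem_erase.2 ⟨hge, hg⟩)
  obtain ⟨z, hz⟩ : (e \ f).Nonempty :=
    Finset.sdiff_nonempty.2 fun hsub => hfe (hA.eq_of_subset he hfA hsub).symm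
  obtain ⟨hze, hzf⟩ := Finset.mem_sdiff.1 hz
  refine ⟨z, fun g hg h hh => ?_, ⟨e.erase z, ?_⟩, ⟨f, ?_⟩⟩
  · rw [Finset.mem_memberSubfamily] at hg
    rw [Finset.mem_nonMemberSubfamily] at hh
    simpa [hg.2] using hA.erase_subset_of_extremal he hfA hmin hmax' hz hg.1
      (Finset.mem_insert_self z g) hh.1 hh.2
  · simp [Finset.insert_erase hze, he]
  · simp [hfA, hzf]

theorem IsOneSperner.nonMemberSubfamily (hA : IsOneSperner A) (z : V) :
    IsOneSperner (A.nonMemberSubfamily z) :=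
  hA.mono (Finset.filter_subset _ _)

theorem IsOneSperner.memberSubfamily (hA : IsOneSperner A) (z : V) :
    IsOneSperner (A.memberSubfamily z) := by
  intro e he f hf hef
  obtain ⟨heA, hze⟩ := Finset.mem_memberSubfamily.1 he
  obtain ⟨hfA, hzf⟩ := Finset.mem_memberSubfamily.1 hf
  have hne : insert z e ≠ insert z f := by
    intro heq
    exact hef (by rw [← Finset.erase_insert hze, heq, Finset.erase_insert hzf])
  have hmin : min #(insert z e \ insert z f) #(insert z f \ insert z e) = 1 := hA heA hfA hne
  rwa [Finset.insert_sdiff_insert, Finset.insert_sdiff_insert, Finset.sdiff_insert_of_notMem hze,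
    Finset.sdiff_insert_of_notMem hzf] at hmin

/-- The weights `w` and the threshold `t` separate the sets containing a member of `A` from the
other ones. Thus `A` is a threshold hypergraph. -/
def Separates (A : Finset (Finset V)) (w : V → ℕ) (t : ℕ) : Prop :=
  ∀ S, (∃ e ∈ A, e ⊆ S) ↔ t ≤ ∑ v ∈ S, w v

theorem separates_singleton (e : Finset V) :
    Separates {e} (fun v => if v ∈ e then 1 else 0) #e := by
  intro S
  rw [Finset.sum_boole, Nat.cast_id, Finset.filter_mem_eq_inter]
  simp only [Finset.mem_singleton, exists_eq_left]
  exact ⟨fun h => (congrArg Finset.card (Finset.inter_eq_right.2 h)).ge, fun h =>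
    Finset.inter_eq_right.1 (Finset.eq_of_subset_of_card_le Finset.inter_subset_right h)⟩

theorem Separates.exists_supported (h : Separates A w t) :
    ∃ w', (∀ v, w' v ≠ 0 → v ∈ A.sup id) ∧ Separates A w' t := by
  refine ⟨fun v => if v ∈ A.sup id then w v else 0, fun v hv => of_not_not fun h => hv (if_neg h),
    fun S => ?_⟩
  rw [Finset.sum_ite_mem, ← h]
  have subset_sup {e : Finset V} (he : e ∈ A) : e ⊆ A.sup id := Finset.le_sup (f := id) he
  exact exists_congr fun e => and_congr_right fun he =>
    ⟨fun heS => Finset.subset_inter heS (subset_sup he), (·.trans Finset.inter_subset_left)⟩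

theorem exists_subset_iff_memberSubfamily (A : Finset (Finset V)) (z : V) (S : Finset V) :
    (∃ e ∈ A, e ⊆ S) ↔ (z ∈ S ∧ ∃ e ∈ A.memberSubfamily z, e ⊆ S) ∨
      ∃ e ∈ A.nonMemberSubfamily z, e ⊆ S := by
  simp only [Finset.mem_memberSubfamily, Finset.mem_nonMemberSubfamily]
  constructor
  · rintro ⟨e, he, heS⟩
    by_cases hz : z ∈ e
    · exact .inl ⟨heS hz, e.erase z, by simp [Finset.insert_erase hz, he],
        (e.erase_subset z).trans heS⟩
    · exact .inr ⟨e, ⟨he, hz⟩, heS⟩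
  · rintro (⟨hz, e, ⟨he, -⟩, heS⟩ | ⟨e, ⟨he, -⟩, heS⟩)
    · exact ⟨_, he, Finset.insert_subset hz heS⟩
    · exact ⟨e, he, heS⟩

theorem mul_le_mul_add_iff_of_lt {M m x y : ℕ} (hy : y < M) : M * m ≤ M * x + y ↔ m ≤ x := by
  rw [mul_comm, ← Nat.le_div_iff_mul_le (Nat.zero_lt_of_lt hy),
    Nat.mul_add_div (Nat.zero_lt_of_lt hy), Nat.div_eq_of_lt hy, add_zero]

/- With `M` larger than the total `w₂`-weight, the weights `M * w₁ + w₂` compare `w₁`-weights first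
and `w₂`-weights second. By the splitting property every set containing a member of the second
family has full `w₁`-weight `t₁ + k`, so that is the threshold in the absence of `z`; the extra
weight of `z` lowers it to `t₁`. -/
theorem IsSplittingVertex.exists_separates (hz : IsSplittingVertex A z)
    (hne : (A.memberSubfamily z).Nonempty)
    (h₁ : Separates (A.memberSubfamily z) w₁ t₁) (h₂ : Separates (A.nonMemberSubfamily z) w₂ t₂) :
    ∃ w t, Separates A w t := by
  obtain ⟨w₁, hsupp₁, h₁⟩ := h₁.exists_supported
  obtain ⟨w₂, hsupp₂, h₂⟩ := h₂.exists_supported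
  set U₁ := (A.memberSubfamily z).sup id
  set M := ∑ v ∈ (A.nonMemberSubfamily z).sup id, w₂ v + 1
  obtain ⟨k, hk⟩ : ∃ k, ∑ v ∈ U₁, w₁ v = t₁ + k := by
    obtain ⟨e, he⟩ := hne
    exact Nat.exists_eq_add_of_le ((h₁ _).1 ⟨e, he, Finset.le_sup (f := id) he⟩)
  refine ⟨fun v => M * w₁ v + w₂ v + if v = z then M * k + t₂ else 0, M * (t₁ + k) + t₂,
    fun S => ?_⟩
  have hw₁ : ∑ v ∈ S, w₁ v ≤ t₁ + k :=
    hk ▸ Finset.sum_le_sum_of_ne_zero fun v _ => hsupp₁ v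
  have hw₂ : ∑ v ∈ S, w₂ v < M :=
    Nat.lt_succ_of_le (Finset.sum_le_sum_of_ne_zero fun v _ => hsupp₂ v)
  have hfull (hS : t₂ ≤ ∑ v ∈ S, w₂ v) : ∑ v ∈ S, w₁ v = t₁ + k := by
    obtain ⟨f, hf, hfS⟩ := (h₂ S).2 hS
    have hU₁S : U₁ ⊆ S := (Finset.sup_le fun e he => hz e he f hf).trans hfS
    rw [← hk, Finset.sum_subset hU₁S fun v _ => not_imp_comm.1 (hsupp₁ v)]
  rw [exists_subset_iff_memberSubfamily A z, h₁, h₂, Finset.sum_add_distrib,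
    Finset.sum_add_distrib, ← Finset.mul_sum, Finset.sum_ite_eq']
  generalize ∑ v ∈ S, w₁ v = x at *
  generalize ∑ v ∈ S, w₂ v = y at *
  have full_iff : M * (t₁ + k) + t₂ ≤ M * x + y ↔ t₂ ≤ y := by
    refine ⟨fun h => ?_, fun h => by rw [hfull h]; lia⟩
    have hle : t₁ + k ≤ x := (mul_le_mul_add_iff_of_lt hw₂).1 (by lia)
    rw [hw₁.antisymm hle] at h
    lia
  split_ifs with hzS
  · have hle (h : t₂ ≤ y) : t₁ ≤ x := by rw [hfull h]; lia
    rw [and_iff_right hzS, or_iff_left_of_imp hle, ← mul_le_mul_add_iff_of_lt hw₂]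
    lia
  · rw [or_iff_right fun h => hzS h.1, add_zero, full_iff]

theorem IsOneSperner.exists_separates (hA : IsOneSperner A) :
    ∃ w t, Separates A w t := by
  induction hn : #A using Nat.strong_induction_on generalizing A with
  | _ n ih =>
    subst hn
    obtain hcard | hcard := le_or_gt #A 1
    · obtain rfl | ⟨e, he⟩ := A.eq_empty_or_nonempty
      · exact ⟨0, 1, by simp [Separates]⟩
      · obtain rfl : A = {e} :=
          Finset.eq_singleton_iff_unique_mem.2
            ⟨he, fun f hf => Finset.card_le_one.1 hcard f hf e he⟩
        exact ⟨_, _, separates_singleton e⟩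
    · obtain ⟨z, hz, hmem, hnon⟩ := hA.exists_isSplittingVertex hcard
      have hsum := A.card_memberSubfamily_add_card_nonMemberSubfamily z
      obtain ⟨w₁, t₁, h₁⟩ := ih _ (by have := hnon.card_pos; lia) (hA.memberSubfamily z) rfl
      obtain ⟨w₂, t₂, h₂⟩ := ih _ (by have := hmem.card_pos; lia) (hA.nonMemberSubfamily z) rfl
      exact hz.exists_separates hmem h₁ h₂

end OneSperner

section ForbiddenFree

variable {V W : Type*} {G : SimpleGraph V} {H : SimpleGraph W} {u v a b c d p : V}

/-- An injective map of a linearly ordered graph which respects adjacency and non-adjacency of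
pairs listed in increasing order is an embedding. -/
def embeddingOfLT [LinearOrder W] (f : W → V) (hf : Injective f)
    (hadj : ∀ i j, i < j → (G.Adj (f i) (f j) ↔ H.Adj i j)) : H ↪g G where
  toFun := f
  inj' := hf
  map_rel_iff' {i j} := by
    obtain hij | rfl | hij := lt_trichotomy i j
    · exact hadj i j hij
    · simp
    · rw [G.adj_comm, H.adj_comm, ← hadj j i hij]
      rfl

theorem isIndContained_of_twinFree [LinearOrder W] (H : SimpleGraph W)
    (hH : ∀ i j, (∀ k, H.Adj i k ↔ H.Adj j k) → i = j) (f : W → V)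
    (hadj : ∀ i j, i < j → (G.Adj (f i) (f j) ↔ H.Adj i j)) : H ⊴ G := by
  have hadj' (i j : W) : G.Adj (f i) (f j) ↔ H.Adj i j := by
    obtain hij | rfl | hij := lt_trichotomy i j
    · exact hadj i j hij
    · simp
    · rw [G.adj_comm, H.adj_comm, hadj j i hij]
  exact ⟨embeddingOfLT f (fun i j hij => hH i j fun k => by rw [← hadj', hij, hadj']) hadj⟩

theorem isIndContained_sum {W' : Type*} {K : SimpleGraph W'} (f : H ↪g G) (g : K ↪g G)
    (hH : ∀ i, ∃ k, H.Adj i k) (hfg : ∀ i j, ¬ G.Adj (f i) (g j)) : H ⊕g K ⊴ G := by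
  have hne (i : W) (j : W') : f i ≠ g j := by
    intro hij
    obtain ⟨k, hk⟩ := hH i
    exact hfg k j (hij ▸ f.map_adj_iff.2 hk.symm)
  refine ⟨⟨⟨Sum.elim f g, f.injective.sumElim g.injective hne⟩, ?_⟩⟩
  rintro (i | i) (j | j)
  · simp
  · simp [hfg]
  · simp [hfg, G.adj_comm (g i)]
  · simp

theorem IsFree.adj_of_four_cycle (hF : IsFree forbidden G) (hab : G.Adj a b) (hbc : G.Adj b c)
    (hcd : G.Adj c d) (hda : G.Adj d a) (hac : ¬ G.Adj a c) (hne_ac : a ≠ c) (hne_bd : b ≠ d) :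
    G.Adj b d := by
  by_contra hbd
  have hinj : Injective ![a, b, c, d] := by
    simp [Injective, Fin.forall_fin_succ, *, hab.ne, hbc.ne, hcd.ne, hda.ne, Ne.symm]
  refine hF 0 ⟨embeddingOfLT (H := cycleGraph 4) ![a, b, c, d] hinj ?_⟩
  simp +decide [Fin.forall_fin_succ, cycleGraph_adj, G.adj_comm a d, *]

/-- `u` and `v` are non-adjacent, `a` and `b` are distinct neighbors of `u` only, and `c` and `d`
are distinct neighbors of `v` only. Each forbidden graph on six vertices consists of six such
vertices. -/
structure PrivatePairs (G : SimpleGraph V) (u v a b c d : V) : Prop where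
  ne_ab : a ≠ b
  ne_cd : c ≠ d
  not_adj_vu : ¬ G.Adj v u
  adj_ua : G.Adj u a
  adj_ub : G.Adj u b
  adj_vc : G.Adj v c
  adj_vd : G.Adj v d
  not_adj_uc : ¬ G.Adj u c
  not_adj_ud : ¬ G.Adj u d
  not_adj_va : ¬ G.Adj v a
  not_adj_vb : ¬ G.Adj v b

namespace PrivatePairs

theorem swap_sides (h : PrivatePairs G u v a b c d) : PrivatePairs G v u c d a b where
  __ := h
  ne_ab := h.ne_cd
  ne_cd := h.ne_ab
  not_adj_vu := mt G.adj_symm h.not_adj_vu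
  adj_ua := h.adj_vc
  adj_ub := h.adj_vd
  adj_vc := h.adj_ua
  adj_vd := h.adj_ub
  not_adj_uc := h.not_adj_va
  not_adj_ud := h.not_adj_vb
  not_adj_va := h.not_adj_uc
  not_adj_vb := h.not_adj_ud

theorem swap_left (h : PrivatePairs G u v a b c d) : PrivatePairs G u v b a c d where
  __ := h
  ne_ab := h.ne_ab.symm
  adj_ua := h.adj_ub
  adj_ub := h.adj_ua
  not_adj_va := h.not_adj_vb
  not_adj_vb := h.not_adj_va

theorem swap_right (h : PrivatePairs G u v a b c d) : PrivatePairs G u v a b d c :=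
  h.swap_sides.swap_left.swap_sides

theorem adj_of_common_neighbor (h : PrivatePairs G u v a b c d) (hF : IsFree forbidden G)
    (hac : G.Adj a c) (hbc : G.Adj b c) : G.Adj a b :=
  hF.adj_of_four_cycle h.adj_ua hac hbc.symm h.adj_ub.symm h.not_adj_uc
    (fun huc => h.not_adj_vu (huc ▸ h.adj_vc)) h.ne_ab

theorem not_adj_of_common_neighbor (h : PrivatePairs G u v a b c d) (hF : IsFree forbidden G)
    (hac : G.Adj a c) (hbc : G.Adj b c) : ¬ G.Adj b d := by
  intro hbd
  have hab := h.adj_of_common_neighbor hF hac hbc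
  have hcd := h.swap_left.swap_sides.adj_of_common_neighbor hF hbc.symm hbd.symm
  cases h
  by_cases had : G.Adj a d
  · refine hF 12 (isIndContained_of_twinFree F13 (by decide) ![u, a, b, c, d, v] ?_)
    simp [Fin.forall_fin_succ, F13, G.adj_comm _ v, *]
  · refine hF 11 (isIndContained_of_twinFree F12 (by decide) ![u, a, b, c, d, v] ?_)
    simp [Fin.forall_fin_succ, F12, G.adj_comm _ v, *]

theorem not_common_neighbor (h : PrivatePairs G u v a b c d) (hF : IsFree forbidden G)
    (hac : G.Adj a c) : ¬ G.Adj b c := by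
  intro hbc
  have hab := h.adj_of_common_neighbor hF hac hbc
  have hbd := h.not_adj_of_common_neighbor hF hac hbc
  have had := h.swap_left.not_adj_of_common_neighbor hF hbc hac
  cases h
  by_cases hcd : G.Adj c d
  · refine hF 10 (isIndContained_of_twinFree F11 (by decide) ![u, a, b, c, v, d] ?_)
    simp [Fin.forall_fin_succ, F11, G.adj_comm _ v, *]
  · refine hF 8 (isIndContained_of_twinFree F9 (by decide) ![u, a, b, c, v, d] ?_)
    simp [Fin.forall_fin_succ, F9, G.adj_comm _ v, *]

theorem not_adj_of_adj (h : PrivatePairs G u v a b c d) (hF : IsFree forbidden G)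
    (hac : G.Adj a c) : ¬ G.Adj b d := by
  intro hbd
  have hbc := h.not_common_neighbor hF hac
  have had := h.swap_left.swap_right.not_common_neighbor hF hbd
  have hne_ad : a ≠ d := fun had => h.not_adj_va (had ▸ h.adj_vd)
  have hne_bc : b ≠ c := fun hbc => h.not_adj_vb (hbc ▸ h.adj_vc)
  have huv := mt G.adj_symm h.not_adj_vu
  cases h
  by_cases hab : G.Adj a b <;> by_cases hcd : G.Adj c d
  · exact hbc (hF.adj_of_four_cycle hab hbd hcd.symm hac.symm had hne_ad hne_bc)
  · refine hF 1 (isIndContained_of_twinFree (cycleGraph 5) (by decide) ![a, c, v, d, b] ?_)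
    simp +decide [Fin.forall_fin_succ, cycleGraph_adj, G.adj_comm, *]
  · refine hF 1 (isIndContained_of_twinFree (cycleGraph 5) (by decide) ![u, a, c, d, b] ?_)
    simp +decide [Fin.forall_fin_succ, cycleGraph_adj, G.adj_comm, *]
  · refine hF 2 (isIndContained_of_twinFree (cycleGraph 6) (by decide) ![u, a, c, v, d, b] ?_)
    simp +decide [Fin.forall_fin_succ, cycleGraph_adj, G.adj_comm, *]

theorem not_adj_cross (h : PrivatePairs G u v a b c d) (hF : IsFree forbidden G) :
    ¬ G.Adj a c := by
  intro hac
  have hbc := h.not_common_neighbor hF hac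
  have hbd := h.not_adj_of_adj hF hac
  have had := mt G.adj_symm (h.swap_sides.not_common_neighbor hF hac.symm)
  have huv := mt G.adj_symm h.not_adj_vu
  cases h
  by_cases hab : G.Adj a b <;> by_cases hcd : G.Adj c d
  · refine hF 9 (isIndContained_of_twinFree F10 (by decide) ![b, u, a, c, v, d] ?_)
    simp [Fin.forall_fin_succ, F10, G.adj_comm, *]
  · refine hF 7 (isIndContained_of_twinFree F8 (by decide) ![b, u, a, c, v, d] ?_)
    simp [Fin.forall_fin_succ, F8, G.adj_comm, *]
  · refine hF 7 (isIndContained_of_twinFree F8 (by decide) ![d, v, c, a, u, b] ?_)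
    simp [Fin.forall_fin_succ, F8, G.adj_comm, *]
  · refine hF 3 (isIndContained_of_twinFree (pathGraph 6) (by decide) ![b, u, a, c, v, d] ?_)
    simp [Fin.forall_fin_succ, pathGraph_adj, G.adj_comm, *]

end PrivatePairs

theorem injective_vec_three {x y z : V} (hxy : x ≠ y) (hxz : x ≠ z) (hyz : y ≠ z) :
    Injective ![x, y, z] := by
  simp [Injective, Fin.forall_fin_succ, hxy, hxz, hyz, hxy.symm, hxz.symm, hyz.symm]

/-- The induced path on three vertices with center `y`. -/
def pathEmbedding {x y z : V} (hyx : G.Adj y x) (hyz : G.Adj y z) (hne : x ≠ z)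
    (hxz : ¬ G.Adj x z) : pathGraph 3 ↪g G :=
  embeddingOfLT ![x, y, z] (injective_vec_three hyx.ne' hne hyz.ne)
    (by simp [Fin.forall_fin_succ, pathGraph_adj, G.adj_comm x y, *])

/-- The triangle on three pairwise adjacent vertices. -/
def triangleEmbedding {x y z : V} (hyx : G.Adj y x) (hyz : G.Adj y z) (hxz : G.Adj x z) :
    completeGraph (Fin 3) ↪g G :=
  embeddingOfLT ![x, y, z] (injective_vec_three hyx.ne' hxz.ne hyz.ne)
    (by simp [Fin.forall_fin_succ, G.adj_comm x y, *])

theorem IsFree.not_privatePairs (hF : IsFree forbidden G) : ¬ PrivatePairs G u v a b c d := by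
  intro h
  have hcross : ∀ i j, ¬ G.Adj (![a, u, b] i) (![c, v, d] j) := by
    have hac := h.not_adj_cross hF
    have had := h.swap_right.not_adj_cross hF
    have hbc := h.swap_left.not_adj_cross hF
    have hbd := h.swap_left.swap_right.not_adj_cross hF
    cases h
    simp [Fin.forall_fin_succ, G.adj_comm _ v, *]
  by_cases hab : G.Adj a b <;> by_cases hcd : G.Adj c d
  · exact hF 6 (isIndContained_sum (triangleEmbedding h.adj_ua h.adj_ub hab)
      (triangleEmbedding h.adj_vc h.adj_vd hcd) (by decide) hcross)
  · exact hF 5 (isIndContained_sum (pathEmbedding h.adj_vc h.adj_vd h.ne_cd hcd)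
      (triangleEmbedding h.adj_ua h.adj_ub hab) (by decide) fun i j => mt G.adj_symm (hcross j i))
  · exact hF 5 (isIndContained_sum (pathEmbedding h.adj_ua h.adj_ub h.ne_ab hab)
      (triangleEmbedding h.adj_vc h.adj_vd hcd) (by decide) hcross)
  · exact hF 4 (isIndContained_sum (pathEmbedding h.adj_ua h.adj_ub h.ne_ab hab)
      (pathEmbedding h.adj_vc h.adj_vd h.ne_cd hcd) (by decide) hcross)

theorem IsFree.not_adj_of_induced_path (hF : IsFree forbidden G) (hbu : G.Adj b u)
    (huv : G.Adj u v) (hvd : G.Adj v d) (hbv : ¬ G.Adj b v) (hbd : ¬ G.Adj b d) (hud : ¬ G.Adj u d)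
    (hpb : G.Adj p b) (hpv : ¬ G.Adj p v) : ¬ G.Adj p d := by
  intro hpd
  by_cases hpu : G.Adj p u
  · exact hud (hF.adj_of_four_cycle hpu huv hvd hpd.symm hpv (by rintro rfl; exact hbv hpb.symm)
      (by rintro rfl; exact hbd hbu))
  · refine hF 1 (isIndContained_of_twinFree (cycleGraph 5) (by decide) ![p, b, u, v, d] ?_)
    simp +decide [Fin.forall_fin_succ, cycleGraph_adj, *]

theorem IsFree.subsingleton_sdiff_of_not_adj (hF : IsFree forbidden G) (huv : ¬ G.Adj u v) :
    (G.neighborSet u \ G.neighborSet v).Subsingleton ∨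
      (G.neighborSet v \ G.neighborSet u).Subsingleton := by
  by_contra! h
  obtain ⟨⟨a, ⟨hua, hva⟩, b, ⟨hub, hvb⟩, hab⟩, c, ⟨hvc, huc⟩, d, ⟨hvd, hud⟩, hcd⟩ := h
  exact hF.not_privatePairs ⟨hab, hcd, mt G.adj_symm huv, hua, hub, hvc, hvd, huc, hud, hva, hvb⟩

/- If `b` and `d` are private neighbors of `u` and `v`, then by minimality `b` and `d` have private
neighbors `p` and `q` in turn, and now `b` and `d` are non-adjacent vertices with private neighbors
`u, p` and `v, q`. -/
theorem IsFree.subsingleton_sdiff_of_adj (hF : IsFree forbidden G) (huv : G.Adj u v)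
    (hu : Minimal (· ∈ Set.range G.neighborSet) (G.neighborSet u))
    (hv : Minimal (· ∈ Set.range G.neighborSet) (G.neighborSet v)) :
    (G.neighborSet u \ G.neighborSet v).Subsingleton ∨
      (G.neighborSet v \ G.neighborSet u).Subsingleton := by
  by_contra! h
  obtain ⟨b, ⟨hub, hvb⟩, hbv⟩ := h.1.exists_ne v
  obtain ⟨d, ⟨hvd, hud⟩, hdu⟩ := h.2.exists_ne u
  simp only [mem_neighborSet] at hub hvb hvd hud
  have hbd : ¬ G.Adj b d := fun hbd =>
    hud (hF.adj_of_four_cycle hub.symm huv hvd hbd.symm (mt G.adj_symm hvb) hbv hdu.symm)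
  obtain ⟨p, hbp, hvp⟩ : ∃ p, G.Adj b p ∧ ¬ G.Adj v p :=
    Set.not_subset.1 fun hsub => hbd (hv.2 ⟨b, rfl⟩ hsub hvd)
  obtain ⟨q, hdq, huq⟩ : ∃ q, G.Adj d q ∧ ¬ G.Adj u q :=
    Set.not_subset.1 fun hsub => hbd (hu.2 ⟨d, rfl⟩ hsub hub).symm
  have hbv : ¬ G.Adj b v := mt G.adj_symm hvb
  have hdu : ¬ G.Adj d u := mt G.adj_symm hud
  have hdb : ¬ G.Adj d b := mt G.adj_symm hbd
  have hpd : ¬ G.Adj p d :=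
    hF.not_adj_of_induced_path hub.symm huv hvd hbv hbd hud hbp.symm (mt G.adj_symm hvp)
  have hqb : ¬ G.Adj q b :=
    hF.not_adj_of_induced_path hvd.symm huv.symm hub hdu hdb hvb hdq.symm (mt G.adj_symm huq)
  have hne_up : u ≠ p := by rintro rfl; exact hvp huv.symm
  have hne_vq : v ≠ q := by rintro rfl; exact huq huv
  exact hF.not_privatePairs ⟨hne_up, hne_vq, hdb, hub.symm, hbp, hvd.symm, hdq, hbv,
    mt G.adj_symm hqb, hdu, mt G.adj_symm hpd⟩

end ForbiddenFree

section MinimalNeighborhoods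

variable {V : Type*} [Fintype V] {G : SimpleGraph V} {e : Finset V}

open Classical in
/-- The neighborhoods of vertices of `G` which are minimal with respect to inclusion. They form the
hypergraph of prime implicants of the neighborhood function. -/
noncomputable def minimalNeighborhoods (G : SimpleGraph V) : Finset (Finset V) :=
  {e | Minimal (· ∈ Set.range G.neighborSet) (e : Set V)}

theorem mem_minimalNeighborhoods :
    e ∈ minimalNeighborhoods G ↔ Minimal (· ∈ Set.range G.neighborSet) (e : Set V) := by
  simp [minimalNeighborhoods]

theorem exists_mem_minimalNeighborhoods_subset (G : SimpleGraph V) (v : V) :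
    ∃ e ∈ minimalNeighborhoods G, (e : Set V) ⊆ G.neighborSet v := by
  classical
  obtain ⟨s, hsv, hs⟩ := exists_minimal_le_of_wellFoundedLT (· ∈ Set.range G.neighborSet)
    (G.neighborSet v) ⟨v, rfl⟩
  exact ⟨s.toFinset, mem_minimalNeighborhoods.2 (by simpa using hs), by simpa using hsv⟩

theorem isTotalDominating_iff [DecidableEq V] (S : Finset V) :
    IsTotalDominating G S ↔ ¬ ∃ e ∈ minimalNeighborhoods G, e ⊆ Sᶜ := by
  simp only [not_exists, not_and, Finset.not_subset, Finset.mem_compl, not_not]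
  constructor
  · intro h e he
    obtain ⟨⟨v, hv⟩, -⟩ := mem_minimalNeighborhoods.1 he
    obtain ⟨x, hxS, hvx⟩ := h v
    exact ⟨x, Finset.mem_coe.1 (hv ▸ hvx), hxS⟩
  · intro h v
    obtain ⟨e, he, hev⟩ := exists_mem_minimalNeighborhoods_subset G v
    obtain ⟨x, hxe, hxS⟩ := h e he
    exact ⟨x, hxS, hev hxe⟩

theorem IsFree.isOneSperner_minimalNeighborhoods [DecidableEq V] (hF : IsFree forbidden G) :
    IsOneSperner (minimalNeighborhoods G) := by
  intro e he f hf hef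
  replace he := mem_minimalNeighborhoods.1 he
  replace hf := mem_minimalNeighborhoods.1 hf
  have hsub : (e \ f : Set V).Subsingleton ∨ (f \ e : Set V).Subsingleton := by
    obtain ⟨u, hu⟩ := he.prop
    obtain ⟨v, hv⟩ := hf.prop
    rw [← hu] at he ⊢
    rw [← hv] at hf ⊢
    by_cases huv : G.Adj u v
    · exact hF.subsingleton_sdiff_of_adj huv he hf
    · exact hF.subsingleton_sdiff_of_not_adj huv
  rw [← Finset.coe_sdiff, ← Finset.coe_sdiff, ← Finset.card_le_one_iff_subsingleton,
    ← Finset.card_le_one_iff_subsingleton] at hsub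
  have hef_pos : 0 < #(e \ f) :=
    Finset.card_pos.2 <| Finset.sdiff_nonempty.2 fun hsub =>
      hef (Finset.coe_injective (hf.eq_of_le he.prop (Finset.coe_subset.2 hsub)))
  have hfe_pos : 0 < #(f \ e) :=
    Finset.card_pos.2 <| Finset.sdiff_nonempty.2 fun hsub =>
      hef (Finset.coe_injective (he.eq_of_le hf.prop (Finset.coe_subset.2 hsub)).symm)
  lia

end MinimalNeighborhoods

theorem IsFree.isTotalDomishold {V : Type*} [Finite V] {G : SimpleGraph V}
    (hF : IsFree forbidden G) : IsTotalDomishold G := by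
  classical
  have := Fintype.ofFinite V
  obtain ⟨w, t, hw⟩ := hF.isOneSperner_minimalNeighborhoods.exists_separates
  refine ⟨fun v => w v, max 0 (∑ v, (w v : ℝ) + 1 - t), fun v => Nat.cast_nonneg _,
    le_max_left _ _, fun S => ?_⟩
  have hadd : ∑ v ∈ S, w v + ∑ v ∈ Sᶜ, w v = ∑ v, w v := Finset.sum_add_sum_compl S w
  rw [isTotalDominating_iff, hw Sᶜ, max_le_iff,
    and_iff_right (Finset.sum_nonneg fun v _ => Nat.cast_nonneg _), sub_le_iff_le_add,
    ← Nat.cast_sum, ← Nat.cast_sum]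
  norm_cast
  lia

theorem IsFree.induce {V : Type*} {ι : Type*} {F : ι → Σ W : Type, SimpleGraph W}
    {G : SimpleGraph V} (hF : IsFree F G) (s : Set V) : IsFree F (G.induce s) :=
  fun i hi => hF i (hi.trans ⟨Embedding.induce s⟩)

end TotalDomishold

theorem mainTheorem1 {V : Type*} [Finite V] (G : SimpleGraph V) :
    List.TFAE [
      TotalDomishold.IsHereditaryTotalDomishold G,
      TotalDomishold.IsHereditaryTwoAsummable G,
      TotalDomishold.IsFree TotalDomishold.forbidden G] := by
  tfae_have 1 → 2 := fun h s => (h s).isAsummable 2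
  tfae_have 2 → 3 := fun h => h.isFree
  tfae_have 3 → 1 := fun h s => (h.induce s).isTotalDomishold
  tfae_finish
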